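/- Let $\lambda_i>0$ for $i\ge 0$, $\mu_i>0$ for $i\ge 1$ and $\mu_0\ge 0$. Let $\mathcal X=\{X(t),\,t\ge 0\}$ be a birth-death process on $S=\{0,1,2,\dots\}$ with birth rates $\lambda_i$ and death rates $\mu_i$, that is, a right-continuous continuous-time Markov chain with $q$-matrix $q_{i,i+1}=\lambda_i$, $q_{i+1,i}=\mu_{i+1}$, $q_{ii}=-(\lambda_i+\mu_i)$, $q_{ij}=0$ for $|i-j|>1$, whose transition probabilities $P_{ij}(t)=\mathbb P(X(t)=j\mid X(0)=i)$, $i,j\in S$, satisfy both the backward and the forward Kolmogorov equations; the process may leave $S$ from state $0$, at rate $\mu_0$, to an absorbing state $-1$, or by explosion to an absorbing state $\infty$. Let $T_{ij}$ be the (possibly infinite) first hitting time of state $j$ when the process starts in state $i\ne j$. Put $\pi_0=1$, $\pi_n=\dfrac{\lambda_0\lambda_1\cdots\lambda_{n-1}}{\mu_1\mu_2\cdots\mu_n}$ for $n\ge 1$, and, for $0\le n\le\infty$, $K_n=\sum_{i=0}^n\pi_i$ and $L_n=\sum_{i=0}^n(\lambda_i\pi_i)^{-1}$ (where $K_\infty$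 and $L_\infty$ may be infinite), and $$C=\sum_{n=0}^\infty(\lambda_n\pi_n)^{-1}K_n,\qquad D=\sum_{n=0}^\infty(\lambda_n\pi_n)^{-1}(K_\infty-K_n).$$ Then, for every $n\ge 1$, $$\mathbb P(T_{0n}<\infty)=\frac1{1+\mu_0L_{n-1}},$$ and, if $C+D=\infty$, also $$\mathbb P(T_{n0}<\infty)=1-\frac{L_{n-1}}{L_\infty},$$ where the quotient is $0$ if $L_\infty=\infty$. -/

import Mathlib

open MeasureTheory
open scoped NNReal ENNReal Topology

namespace BirthDeath

/-- The extended state space `{-1} ∪ {0, 1, 2, …} ∪ {∞}` of a birth-death process: `⊥` is the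
absorbing state `-1`, entered from state `0` when `μ₀ > 0`, and `⊤` is the absorbing state `∞`,
entered by explosion. Its order topology makes `⊥` and every natural number isolated, and the
natural numbers converge to `⊤`. -/
abbrev State : Type := WithBot ℕ∞

/-- The natural number `i` as a state. -/
def st (i : ℕ) : State := ((i : ℕ∞) : WithBot ℕ∞)

/-- The entries of the `q`-matrix on `S = {0, 1, 2, …}` with birth rates `lam` and death rates
`mu`. -/
def q (lam mu : ℕ → ℝ) (i j : ℕ) : ℝ :=
  if j = i + 1 then lam i
  else if i = j + 1 then mu i
  else if i = j then -(lam i + mu i)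
  else 0

/-- `P t x y`, for `t ≥ 0`, are the transition probabilities of a birth-death process with birth
rates `lam` and death rates `mu`: a stochastic transition function on the extended state space for
which `-1` and `∞` are absorbing, whose restriction to `S` satisfies the backward and the forward
Kolmogorov equations, and for which the state `-1` is entered from state `0` at rate `mu 0`. -/
structure IsTransitionFunction (lam mu : ℕ → ℝ) (P : ℝ → State → State → ℝ) : Prop where
  nonneg : ∀ t, 0 ≤ t → ∀ x y, 0 ≤ P t x y
  hasSum_one : ∀ t, 0 ≤ t → ∀ x, HasSum (fun y => P t x y) 1
  zero : ∀ x y, P 0 x y = if x = y then 1 else 0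
  chapman_kolmogorov : ∀ s t, 0 ≤ s → 0 ≤ t → ∀ x y,
    HasSum (fun z => P s x z * P t z y) (P (s + t) x y)
  absorbing_bot : ∀ t, 0 ≤ t → P t ⊥ ⊥ = 1
  absorbing_top : ∀ t, 0 ≤ t → P t ⊤ ⊤ = 1
  /-- `P'ᵢⱼ = ∑ₖ qᵢₖ Pₖⱼ`; the terms with `k > i + 1` vanish. -/
  backward : ∀ t, 0 ≤ t → ∀ i j : ℕ,
    HasDerivWithinAt (fun u => P u (st i) (st j))
      (∑ k ∈ Finset.range (i + 2), q lam mu i k * P t (st k) (st j)) (Set.Ici 0) t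
  /-- `P'ᵢⱼ = ∑ₖ Pᵢₖ qₖⱼ`; the terms with `k > j + 1` vanish. -/
  forward : ∀ t, 0 ≤ t → ∀ i j : ℕ,
    HasDerivWithinAt (fun u => P u (st i) (st j))
      (∑ k ∈ Finset.range (j + 2), P t (st i) (st k) * q lam mu k j) (Set.Ici 0) t
  evanescence : ∀ t, 0 ≤ t → ∀ i : ℕ,
    HasDerivWithinAt (fun u => P u (st i) ⊥) (P t (st i) (st 0) * mu 0) (Set.Ici 0) t

/-- Under the probability measure `Pr`, `X` is a continuous-time Markov chain with right-continuous
paths, transition function `P` and initial state `x`. -/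
structure IsMarkovChainFrom {Ω : Type*} [MeasurableSpace Ω] (P : ℝ → State → State → ℝ)
    (x : State) (X : ℝ≥0 → Ω → State) (Pr : Measure Ω) : Prop where
  isProbabilityMeasure : IsProbabilityMeasure Pr
  measurable : ∀ t y, MeasurableSet {ω | X t ω = y}
  rightContinuous : ∀ ω t, ContinuousWithinAt (fun u => X u ω) (Set.Ici t) t
  start : Pr {ω | X 0 ω = x} = 1
  /-- The Markov property: for times `t 0 ≤ t 1 ≤ … ≤ t (m + 1)`, the conditional probability of
  `X (t (m + 1)) = y (m + 1)` given `X (t l) = y l`, `l ≤ m`, is the transition probability from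
  `y m` to `y (m + 1)` (written without a division). -/
  markov : ∀ (m : ℕ) (t : ℕ → ℝ≥0) (y : ℕ → State), Monotone t →
    Pr {ω | ∀ l ≤ m + 1, X (t l) ω = y l} =
      Pr {ω | ∀ l ≤ m, X (t l) ω = y l} *
        ENNReal.ofReal (P ((t (m + 1) : ℝ) - (t m : ℝ)) (y m) (y (m + 1)))

/-- The first time at which `X` visits the state `j ∈ S`, equal to `⊤` if this never happens. -/
noncomputable def hitTime {Ω : Type*} (X : ℝ≥0 → Ω → State) (j : ℕ) : Ω → WithTop ℝ≥0 :=
  hittingAfter X {st j} 0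

/-- `πₙ = (λ₀ ⋯ λₙ₋₁) / (μ₁ ⋯ μₙ)`. -/
noncomputable def piCoeff (lam mu : ℕ → ℝ) (n : ℕ) : ℝ :=
  (∏ i ∈ Finset.range n, lam i) / ∏ i ∈ Finset.range n, mu (i + 1)

/-- `Kₙ = π₀ + ⋯ + πₙ`. -/
noncomputable def K (lam mu : ℕ → ℝ) (n : ℕ) : ℝ :=
  ∑ i ∈ Finset.range (n + 1), piCoeff lam mu i

/-- `Lₙ = (λ₀π₀)⁻¹ + ⋯ + (λₙπₙ)⁻¹`. -/
noncomputable def L (lam mu : ℕ → ℝ) (n : ℕ) : ℝ :=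
  ∑ i ∈ Finset.range (n + 1), (lam i * piCoeff lam mu i)⁻¹

/-- `K_∞`, possibly infinite. -/
noncomputable def KInf (lam mu : ℕ → ℝ) : ℝ≥0∞ :=
  ∑' i, ENNReal.ofReal (piCoeff lam mu i)

/-- `L_∞`, possibly infinite. -/
noncomputable def LInf (lam mu : ℕ → ℝ) : ℝ≥0∞ :=
  ∑' i, ENNReal.ofReal ((lam i * piCoeff lam mu i)⁻¹)

/-- `C = ∑ₙ (λₙπₙ)⁻¹ Kₙ`, possibly infinite. -/
noncomputable def C (lam mu : ℕ → ℝ) : ℝ≥0∞ :=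
  ∑' n, ENNReal.ofReal ((lam n * piCoeff lam mu n)⁻¹) * ENNReal.ofReal (K lam mu n)

/-- `D = ∑ₙ (λₙπₙ)⁻¹ (K_∞ - Kₙ)`, possibly infinite. -/
noncomputable def D (lam mu : ℕ → ℝ) : ℝ≥0∞ :=
  ∑' n, ENNReal.ofReal ((lam n * piCoeff lam mu n)⁻¹) * (KInf lam mu - ENNReal.ofReal (K lam mu n))

end BirthDeath

/-! A nonnegative function `w` whose generator is nonpositive off the target bounds hitting
probabilities from above: stopped along the times `l * 2⁻ᵏ`, it gives a supermartingale, and by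
right continuity the visits of the process to a state of `S` are seen as `k → ∞`. The generator only
controls small times, so `w` is first perturbed by `ε` times a mean exit time, which makes the
generator strictly negative. The perturbed function also loses a fixed amount in each step, so that
the process leaves every finite set; this bounds the probability of *not* reaching the target.

With the scale function `s n = ∑ i < n, (λᵢπᵢ)⁻¹`, the function `1 + μ₀ s` that vanishes at `-1` is
harmonic on `S`, and `s` is harmonic on `{1, 2, …}`. The first yields both bounds for
`ℙ(T₀ₙ < ∞)`, the second the lower bound for `ℙ(Tₙ₀ < ∞)`.

For the upper bound the process might return to `0` after going far away, and the decreasing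
function `r n = L_∞ - s n`, which vanishes at `∞`, has to be excessive. If it is not, the boundary
flux in the forward equations, summed against `r`, forces the expected time spent in `j` up to time
`t` to be at least a positive multiple of `πⱼ` for large `j`. These times add up to at most `t`, so
`K_∞ < ∞`, and together with `L_∞ < ∞` this contradicts `C + D = ∞`.
-/

namespace BirthDeath

open Filter

section DiscreteChain

variable {Ω α : Type*}

open Classical in
/-- Along the path `y`, the value at time `m` of `w` stopped at the exit from `A`, plus `c` for each
step made before the exit. It is a supermartingale if `w` loses at least `c` on average in each step
from `A`. -/
noncomputable def compensatedStop (A : Set α) (w : α → ℝ≥0∞) (c : ℝ≥0∞) (y : ℕ → α) : ℕ → ℝ≥0∞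
  | 0 => w (y 0)
  | m + 1 => if ∀ l ≤ m, y l ∈ A then w (y (m + 1)) + ↑(m + 1) * c else compensatedStop A w c y m

theorem compensatedStop_of_forall_mem {A : Set α} {w : α → ℝ≥0∞} {c : ℝ≥0∞} {y : ℕ → α} {m : ℕ}
    (h : ∀ l < m, y l ∈ A) : compensatedStop A w c y m = w (y m) + m * c := by
  cases m with
  | zero => simp [compensatedStop]
  | succ m => rw [compensatedStop, if_pos fun l hl => h l (Nat.lt_succ_of_le hl)]

theorem compensatedStop_of_exit {A : Set α} {w : α → ℝ≥0∞} {c : ℝ≥0∞} {y : ℕ → α} {k m : ℕ}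
    (h : ∀ l < k, y l ∈ A) (hk : y k ∉ A) (hkm : k ≤ m) :
    compensatedStop A w c y m = w (y k) + k * c := by
  induction m, hkm using Nat.le_induction with
  | base => exact compensatedStop_of_forall_mem h
  | succ m hkm ih => rw [compensatedStop, if_neg fun hA => hk (hA k hkm), ih]

variable [MeasurableSpace Ω] [MeasurableSpace α]

/-- `Y` is a discrete-time Markov chain with initial state `x₀` and transition matrix `p`. On a
countable state space the Markov property may be stated for single paths. -/
structure IsDiscreteChain (Pr : Measure Ω) (Y : ℕ → Ω → α) (p : α → α → ℝ≥0∞) (x₀ : α) :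
    Prop where
  measurable : ∀ l, Measurable (Y l)
  start : ∀ᵐ ω ∂Pr, Y 0 ω = x₀
  markov : ∀ (m : ℕ) (y : ℕ → α),
    Pr {ω | ∀ l ≤ m + 1, Y l ω = y l} = Pr {ω | ∀ l ≤ m, Y l ω = y l} * p (y m) (y (m + 1))

variable [Countable α] [MeasurableSingletonClass α]

theorem lintegral_comp_eq_tsum (μ : Measure Ω) {Y : Ω → α} (hY : Measurable Y) (g : α → ℝ≥0∞) :
    ∫⁻ ω, g (Y ω) ∂μ = ∑' x, g x * μ (Y ⁻¹' {x}) := by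
  rw [← lintegral_map (measurable_of_countable g) hY, lintegral_countable']
  simp only [Measure.map_apply hY (measurableSet_singleton _)]

namespace IsDiscreteChain

variable {Pr : Measure Ω} {Y : ℕ → Ω → α} {p : α → α → ℝ≥0∞} {x₀ : α}

theorem measure_past_inter_eq_mul (h : IsDiscreteChain Pr Y p x₀) {m : ℕ}
    {H : Set (Fin (m + 1) → α)} {x : α} (hH : ∀ z ∈ H, z (Fin.last m) = x) (y : α) :
    Pr ({ω | (fun l : Fin (m + 1) => Y l ω) ∈ H} ∩ Y (m + 1) ⁻¹' {y}) =
      Pr {ω | (fun l : Fin (m + 1) => Y l ω) ∈ H} * p x y := by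
  set past : Ω → Fin (m + 1) → α := fun ω l => Y l ω
  have hpast : Measurable past := measurable_pi_lambda _ fun l => h.measurable l
  have single_path (z : H) :
      Pr (past ⁻¹' {↑z} ∩ Y (m + 1) ⁻¹' {y}) = Pr (past ⁻¹' {↑z}) * p x y := by
    let path : ℕ → α := fun l => if hl : l < m + 1 then z.1 ⟨l, hl⟩ else y
    have hpath : path m = x := (dif_pos m.lt_succ_self).trans (hH z z.2)
    have hpath' : path (m + 1) = y := by simp [path]
    have hpre : past ⁻¹' {↑z} = {ω | ∀ l ≤ m, Y l ω = path l} := by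
      ext ω
      simp +contextual [past, funext_iff, path, Fin.forall_iff]
    have hpre' : {ω | ∀ l ≤ m, Y l ω = path l} ∩ Y (m + 1) ⁻¹' {y} =
        {ω | ∀ l ≤ m + 1, Y l ω = path l} := by
      ext ω
      simp [Nat.le_succ_iff_eq_or_le, or_imp, forall_and, hpath', and_comm]
    rw [hpre, hpre', h.markov, hpath, hpath']
  have hsingle (z : Fin (m + 1) → α) : MeasurableSet (past ⁻¹' {z}) :=
    hpast (measurableSet_singleton z)
  calc Pr (past ⁻¹' H ∩ Y (m + 1) ⁻¹' {y})
      = ∑' z : H, Pr.restrict (Y (m + 1) ⁻¹' {y}) (past ⁻¹' {↑z}) := by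
        rw [tsum_measure_preimage_singleton H.to_countable fun z _ => hsingle z,
          Measure.restrict_apply (hpast H.to_countable.measurableSet)]
    _ = ∑' z : H, Pr (past ⁻¹' {↑z}) * p x y :=
        tsum_congr fun z => (Measure.restrict_apply (hsingle z)).trans (single_path z)
    _ = Pr (past ⁻¹' H) * p x y := by
        rw [ENNReal.tsum_mul_right,
          tsum_measure_preimage_singleton H.to_countable fun z _ => hsingle z]

theorem measurableSet_forall_mem (h : IsDiscreteChain Pr Y p x₀) (A : Set α) (m : ℕ) :
    MeasurableSet {ω | ∀ l ≤ m, Y l ω ∈ A} := by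
  simp only [Set.ofPred_forall]
  exact .iInter fun l => .iInter fun _ => h.measurable l A.to_countable.measurableSet

theorem setLIntegral_succ (h : IsDiscreteChain Pr Y p x₀) (A : Set α) (w : α → ℝ≥0∞) (m : ℕ) :
    ∫⁻ ω in {ω | ∀ l ≤ m, Y l ω ∈ A}, w (Y (m + 1) ω) ∂Pr =
      ∫⁻ ω in {ω | ∀ l ≤ m, Y l ω ∈ A}, ∑' y, p (Y m ω) y * w y ∂Pr := by
  set μ := Pr.restrict {ω | ∀ l ≤ m, Y l ω ∈ A}
  have hμ {x y : α} : μ (Y m ⁻¹' {x} ∩ Y (m + 1) ⁻¹' {y}) = μ (Y m ⁻¹' {x}) * p x y := by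
    have hx := h.measurable m (measurableSet_singleton x)
    have hy := h.measurable (m + 1) (measurableSet_singleton y)
    rw [Measure.restrict_apply (hx.inter hy), Measure.restrict_apply hx, Set.inter_right_comm]
    convert h.measure_past_inter_eq_mul (m := m)
      (H := {z | z (Fin.last m) = x ∧ ∀ l, z l ∈ A}) (fun z hz => hz.1) y using 3 <;>
    · ext ω
      simp [Fin.forall_iff]
  have law_succ (y : α) : μ (Y (m + 1) ⁻¹' {y}) = ∑' x, μ (Y m ⁻¹' {x}) * p x y := by
    simp only [← hμ]
    rw [← measure_iUnion]
    · congr 1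
      ext ω
      simp
    · exact fun x x' hx => ((Set.disjoint_singleton.2 hx).preimage _).mono
        Set.inter_subset_left Set.inter_subset_left
    · exact fun x => (h.measurable m (measurableSet_singleton x)).inter
        (h.measurable (m + 1) (measurableSet_singleton y))
  rw [lintegral_comp_eq_tsum μ (h.measurable (m + 1)),
    lintegral_comp_eq_tsum μ (h.measurable m) fun x => ∑' y, p x y * w y]
  simp only [law_succ, ← ENNReal.tsum_mul_left, ← ENNReal.tsum_mul_right]
  rw [ENNReal.tsum_comm]
  exact tsum_congr fun x => tsum_congr fun y => by ring

theorem measurable_compensatedStop (h : IsDiscreteChain Pr Y p x₀) (A : Set α) (w : α → ℝ≥0∞)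
    (c : ℝ≥0∞) (m : ℕ) : Measurable fun ω => compensatedStop A w c (fun l => Y l ω) m := by
  have hw (l : ℕ) : Measurable fun ω => w (Y l ω) :=
    (measurable_of_countable w).comp (h.measurable l)
  induction m with
  | zero => exact hw 0
  | succ m ih =>
    classical
    exact .ite (h.measurableSet_forall_mem A m) ((hw (m + 1)).add_const _) ih

theorem lintegral_compensatedStop_le [IsProbabilityMeasure Pr] (h : IsDiscreteChain Pr Y p x₀)
    {A : Set α} {w : α → ℝ≥0∞} {c : ℝ≥0∞} (hw : ∀ x ∈ A, ∑' y, p x y * w y + c ≤ w x) (m : ℕ) :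
    ∫⁻ ω, compensatedStop A w c (fun l => Y l ω) m ∂Pr ≤ w x₀ := by
  induction m with
  | zero =>
    have hstart : (fun ω => w (Y 0 ω)) =ᵐ[Pr] fun _ => w x₀ := h.start.mono fun ω hω => by simp [hω]
    simp [compensatedStop, lintegral_congr_ae hstart]
  | succ m ih =>
    refine le_trans ?_ ih
    set E := {ω | ∀ l ≤ m, Y l ω ∈ A}
    have hE : MeasurableSet E := h.measurableSet_forall_mem A m
    rw [← lintegral_add_compl (fun ω => compensatedStop A w c (fun l => Y l ω) (m + 1)) hE,
      ← lintegral_add_compl (fun ω => compensatedStop A w c (fun l => Y l ω) m) hE]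
    refine add_le_add ?_ (setLIntegral_mono' hE.compl fun ω hω => ?_)
    · calc ∫⁻ ω in E, compensatedStop A w c (fun l => Y l ω) (m + 1) ∂Pr
          = ∫⁻ ω in E, (w (Y (m + 1) ω) + ↑(m + 1) * c) ∂Pr :=
            setLIntegral_congr_fun hE fun ω hω => if_pos hω
        _ = ∫⁻ ω in E, (∑' y, p (Y m ω) y * w y + ↑(m + 1) * c) ∂Pr := by
            rw [lintegral_add_right _ measurable_const, lintegral_add_right _ measurable_const,
              h.setLIntegral_succ]
        _ ≤ ∫⁻ ω in E, compensatedStop A w c (fun l => Y l ω) m ∂Pr := by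
            refine setLIntegral_mono' hE fun ω hω => ?_
            rw [compensatedStop_of_forall_mem fun l hl => hω l hl.le, Nat.cast_succ,
              add_comm (m : ℝ≥0∞), add_mul, one_mul, ← add_assoc]
            gcongr
            exact hw _ (hω m le_rfl)
    · exact (if_neg hω).le

theorem measure_le_of_eventually_one_le [IsProbabilityMeasure Pr] (h : IsDiscreteChain Pr Y p x₀)
    {A : Set α} {w : α → ℝ≥0∞} {c : ℝ≥0∞} (hw : ∀ x ∈ A, ∑' y, p x y * w y + c ≤ w x) {E : Set Ω}
    (hE : ∀ ω ∈ E, ∀ᶠ m in atTop, 1 ≤ compensatedStop A w c (fun l => Y l ω) m) :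
    Pr E ≤ w x₀ := by
  have hmeas := h.measurable_compensatedStop A w c
  calc Pr E ≤ ∫⁻ ω, liminf (fun m => compensatedStop A w c (fun l => Y l ω) m) atTop ∂Pr :=
        meas_le_lintegral₀ (Measurable.liminf hmeas).aemeasurable fun ω hω =>
          le_liminf_of_le (by isBoundedDefault) (hE ω hω)
    _ ≤ liminf (fun m => ∫⁻ ω, compensatedStop A w c (fun l => Y l ω) m ∂Pr) atTop :=
        lintegral_liminf_le hmeas
    _ ≤ w x₀ := liminf_le_of_le (by isBoundedDefault) fun b hb =>
        let ⟨m, hm⟩ := hb.exists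
        hm.trans (h.lintegral_compensatedStop_le hw m)

theorem measure_hit_le [IsProbabilityMeasure Pr] (h : IsDiscreteChain Pr Y p x₀) {B : Set α}
    {w : α → ℝ≥0∞} (hw : ∀ x ∉ B, ∑' y, p x y * w y ≤ w x) (hB : ∀ x ∈ B, 1 ≤ w x) :
    Pr {ω | ∃ l, Y l ω ∈ B} ≤ w x₀ := by
  classical
  refine h.measure_le_of_eventually_one_le (A := Bᶜ) (c := 0) (by simpa using hw) fun ω hω => ?_
  filter_upwards [eventually_ge_atTop (Nat.find hω)] with m hm
  rw [compensatedStop_of_exit (fun l hl => Nat.find_min hω hl) (not_not.2 (Nat.find_spec hω)) hm]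
  exact (hB _ (Nat.find_spec hω)).trans le_self_add

theorem measure_forall_ne_le [IsProbabilityMeasure Pr] (h : IsDiscreteChain Pr Y p x₀) {A : Set α}
    {z : α} {w : α → ℝ≥0∞} {c : ℝ≥0∞} (hc : c ≠ 0) (hw : ∀ x ∈ A, ∑' y, p x y * w y + c ≤ w x)
    (hA : ∀ x ∉ A, x ≠ z → 1 ≤ w x) : Pr {ω | ∀ l, Y l ω ≠ z} ≤ w x₀ := by
  classical
  refine h.measure_le_of_eventually_one_le hw fun ω hω => ?_
  by_cases hstay : ∀ l, Y l ω ∈ A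
  · obtain ⟨k, hk⟩ := ENNReal.exists_nat_mul_gt hc ENNReal.one_ne_top
    filter_upwards [eventually_ge_atTop k] with m hm
    rw [compensatedStop_of_forall_mem fun l _ => hstay l]
    calc 1 ≤ k * c := hk.le
      _ ≤ m * c := by gcongr
      _ ≤ w (Y m ω) + m * c := le_add_self
  · push Not at hstay
    filter_upwards [eventually_ge_atTop (Nat.find hstay)] with m hm
    rw [compensatedStop_of_exit (fun l hl => not_not.1 (Nat.find_min hstay hl))
      (Nat.find_spec hstay) hm]
    exact (hA _ (Nat.find_spec hstay) (hω _)).trans le_self_add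

end IsDiscreteChain

end DiscreteChain

theorem st_injective : Function.Injective st := fun i j h => by simpa [st] using h

@[simp] theorem st_inj {i j : ℕ} : st i = st j ↔ i = j := st_injective.eq_iff

@[simp] theorem st_ne_bot (i : ℕ) : st i ≠ ⊥ := WithBot.coe_ne_bot

theorem state_cases (x : State) : x = ⊥ ∨ x = ⊤ ∨ ∃ i, x = st i := by
  rcases x with _ | _ | i
  exacts [.inl rfl, .inr (.inl rfl), .inr (.inr ⟨i, rfl⟩)]

theorem isOpen_singleton_st (i : ℕ) : IsOpen ({st i} : Set State) := by
  have h := WithBot.isOpenEmbedding_coe.isOpenMap _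
    (ENat.isOpen_singleton (ENat.natCast_ne_top i))
  rwa [Set.image_singleton] at h

section Skeleton

variable {Ω : Type*} {X : ℝ≥0 → Ω → State} {ω : Ω} {j : ℕ}

theorem hitTime_lt_top_iff : hitTime X j ω < ⊤ ↔ ∃ t, X t ω = st j := by
  rw [hitTime, hittingAfter_def]
  simp only [Set.mem_singleton_iff, zero_le, true_and]
  split_ifs with h
  · exact ⟨fun _ => by simpa using h, fun _ => WithTop.coe_lt_top _⟩
  · simpa using h

theorem hitTime_eq_top_iff : hitTime X j ω = ⊤ ↔ ∀ t, X t ω ≠ st j := by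
  rw [← not_lt_top_iff, hitTime_lt_top_iff, not_exists]

/-- The event that the process is in state `j` at some multiple of `2⁻ᵏ`. -/
def dyadicHit (X : ℝ≥0 → Ω → State) (j k : ℕ) : Set Ω :=
  {ω | ∃ l : ℕ, X (l * (2 ^ k)⁻¹) ω = st j}

theorem dyadicHit_mono (X : ℝ≥0 → Ω → State) (j : ℕ) : Monotone (dyadicHit X j) := by
  refine monotone_nat_of_le_succ fun k ω ⟨l, hl⟩ => ⟨l * 2, ?_⟩
  have h : ((l * 2 : ℕ) : ℝ≥0) * (2 ^ (k + 1))⁻¹ = l * (2 ^ k)⁻¹ := by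
    push_cast
    rw [pow_succ]
    field_simp
  rw [h, hl]

theorem tendsto_inv_two_pow : Tendsto (fun k : ℕ => (((2 ^ k)⁻¹ : ℝ≥0) : ℝ)) atTop (𝓝[>] 0) := by
  refine tendsto_nhdsWithin_iff.2 ⟨?_, Eventually.of_forall fun k => by simp⟩
  simpa using tendsto_pow_atTop_nhds_zero_of_lt_one (r := (2 : ℝ)⁻¹) (by norm_num) (by norm_num)

theorem exists_dyadic_mem_Ico {a b : ℝ≥0} (hab : a < b) :
    ∃ k l : ℕ, (l * (2 ^ k)⁻¹ : ℝ≥0) ∈ Set.Ico a b := by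
  obtain ⟨k, hk⟩ := ((tendsto_inv_two_pow.mono_right nhdsWithin_le_nhds).eventually
    (gt_mem_nhds (sub_pos.2 (NNReal.coe_lt_coe.2 hab)))).exists
  have hk' : a + (2 ^ k)⁻¹ < b := by
    rw [← NNReal.coe_lt_coe, NNReal.coe_add]
    linarith
  refine ⟨k, ⌈a * 2 ^ k⌉₊, ?_, ?_⟩
  · rw [← div_eq_mul_inv, le_div_iff₀ (by positivity)]
    exact Nat.le_ceil _
  · calc (⌈a * 2 ^ k⌉₊ : ℝ≥0) * (2 ^ k)⁻¹ < (a * 2 ^ k + 1) * (2 ^ k)⁻¹ := by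
          gcongr
          exact Nat.ceil_lt_add_one zero_le
      _ = a + (2 ^ k)⁻¹ := by field_simp
      _ < b := hk'

theorem hit_subset_iUnion_dyadicHit
    (hX : ∀ ω t, ContinuousWithinAt (fun u => X u ω) (Set.Ici t) t) (j : ℕ) :
    {ω | hitTime X j ω < ⊤} ⊆ ⋃ k, dyadicHit X j k := by
  intro ω hω
  obtain ⟨t, ht⟩ := hitTime_lt_top_iff.1 hω
  have hstay : ∀ᶠ u in 𝓝[≥] t, X u ω = st j :=
    (hX ω t).eventually ((isOpen_singleton_st j).mem_nhds ht)
  obtain ⟨b, htb, hb⟩ := mem_nhdsGE_iff_exists_Ico_subset.1 hstay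
  obtain ⟨k, l, hkl⟩ := exists_dyadic_mem_Ico htb
  exact Set.mem_iUnion.2 ⟨k, l, hb hkl⟩

/-- The discrete `σ`-algebra: `IsMarkovChainFrom.measurable` says that each `X t` is measurable for
it. -/
local instance : MeasurableSpace State := ⊤

local instance : DiscreteMeasurableSpace State := ⟨fun _ => trivial⟩

variable [MeasurableSpace Ω] {P : ℝ → State → State → ℝ} {Pr : Measure Ω} {x : State}

theorem IsMarkovChainFrom.isDiscreteChain (h : IsMarkovChainFrom P x X Pr) (s : ℝ≥0) :
    IsDiscreteChain Pr (fun l : ℕ => X (l * s)) (fun a b => ENNReal.ofReal (P s a b)) x where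
  measurable l := measurable_to_countable' (h.measurable _)
  start := by
    have := h.isProbabilityMeasure
    simp only [Nat.cast_zero, zero_mul]
    exact mem_ae_iff.2 ((prob_compl_eq_zero_iff (h.measurable 0 x)).2 h.start)
  markov m y := by
    rw [h.markov m (fun l => l * s) y fun a b hab => by dsimp only; gcongr]
    congr 3
    push_cast
    ring

theorem IsMarkovChainFrom.measure_hitTime_lt_top_le (h : IsMarkovChainFrom P x X Pr)
    {B : Set State} (hj : st j ∈ B) {w : State → ℝ≥0∞}
    (hw : ∀ᶠ t in 𝓝[>] (0 : ℝ), ∀ y ∉ B, ∑' z, ENNReal.ofReal (P t y z) * w z ≤ w y)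
    (hB : ∀ y ∈ B, 1 ≤ w y) : Pr {ω | hitTime X j ω < ⊤} ≤ w x := by
  have := h.isProbabilityMeasure
  have hskel : ∀ᶠ k in atTop, Pr (dyadicHit X j k) ≤ w x := by
    filter_upwards [tendsto_inv_two_pow.eventually hw] with k hk
    refine (measure_mono ?_).trans ((h.isDiscreteChain ((2 ^ k)⁻¹)).measure_hit_le hk hB)
    exact fun ω ⟨l, hl⟩ => ⟨l, by rwa [hl]⟩
  exact (measure_mono (hit_subset_iUnion_dyadicHit h.rightContinuous j)).trans
    (le_of_tendsto (tendsto_measure_iUnion_atTop (dyadicHit_mono X j)) hskel)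

theorem IsMarkovChainFrom.measure_hitTime_eq_top_le (h : IsMarkovChainFrom P x X Pr)
    {A : Set State} {w : State → ℝ≥0∞} {c : ℝ≥0∞} (hc : c ≠ 0) {s : ℝ≥0}
    (hw : ∀ y ∈ A, ∑' z, ENNReal.ofReal (P s y z) * w z + c ≤ w y)
    (hA : ∀ y ∉ A, y ≠ st j → 1 ≤ w y) : Pr {ω | hitTime X j ω = ⊤} ≤ w x := by
  have := h.isProbabilityMeasure
  have hsub : {ω | hitTime X j ω = ⊤} ⊆ {ω | ∀ l : ℕ, X (l * s) ω ≠ st j} :=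
    fun ω hω l => hitTime_eq_top_iff.1 hω _
  exact (measure_mono hsub).trans ((h.isDiscreteChain s).measure_forall_ne_le hc hw hA)

theorem one_sub_le_measure_hitTime_lt_top [IsProbabilityMeasure Pr] {b : ℝ≥0∞}
    (h : Pr {ω | hitTime X j ω = ⊤} ≤ b) : 1 - b ≤ Pr {ω | hitTime X j ω < ⊤} := by
  have hcover : {ω | hitTime X j ω < ⊤} ∪ {ω | hitTime X j ω = ⊤} = Set.univ :=
    Set.eq_univ_of_forall fun ω =>
      (lt_or_eq_of_le le_top : hitTime X j ω < ⊤ ∨ hitTime X j ω = ⊤)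
  refine tsub_le_iff_right.2 ?_
  calc 1 = Pr ({ω | hitTime X j ω < ⊤} ∪ {ω | hitTime X j ω = ⊤}) := by rw [hcover, measure_univ]
    _ ≤ Pr {ω | hitTime X j ω < ⊤} + b := (measure_union_le _ _).trans (by gcongr)

end Skeleton

section Generator

variable {lam mu : ℕ → ℝ} {P : ℝ → State → State → ℝ}

/-- The function on the state space with values `a` at `-1`, `f i` at `i ∈ S`, and `b` at `∞`. -/
noncomputable def extend (a : ℝ) (f : ℕ → ℝ) (b : ℝ) : State → ℝ :=
  WithBot.recBotCoe a (ENat.recTopCoe b f)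

@[simp] theorem extend_bot (a : ℝ) (f : ℕ → ℝ) (b : ℝ) : extend a f b ⊥ = a := rfl

@[simp] theorem extend_top (a : ℝ) (f : ℕ → ℝ) (b : ℝ) : extend a f b ⊤ = b := rfl

@[simp] theorem extend_st (a : ℝ) (f : ℕ → ℝ) (b : ℝ) (i : ℕ) : extend a f b (st i) = f i := rfl

/-- The state reached by a death in state `i`. -/
def down : ℕ → State
  | 0 => ⊥
  | i + 1 => st i

/-- The generator of the birth-death process. -/
def gen (lam mu : ℕ → ℝ) (f : State → ℝ) (i : ℕ) : ℝ :=
  lam i * (f (st (i + 1)) - f (st i)) + mu i * (f (down i) - f (st i))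

theorem q_up (i : ℕ) : q lam mu i (i + 1) = lam i := if_pos rfl

theorem q_down (i : ℕ) : q lam mu (i + 1) i = mu (i + 1) := by
  rw [q, if_neg (by omega), if_pos rfl]

theorem q_self (i : ℕ) : q lam mu i i = -(lam i + mu i) := by
  rw [q, if_neg (by omega), if_neg (by omega), if_pos rfl]

theorem q_eq_zero {i j : ℕ} (h : i + 2 ≤ j ∨ j + 2 ≤ i) : q lam mu i j = 0 := by
  rw [q, if_neg (by omega), if_neg (by omega), if_neg (by omega)]

theorem sum_q_mul {i N : ℕ} (hN : i + 2 ≤ N) (f : State → ℝ) :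
    (if i = 0 then mu 0 else 0) * f ⊥ + ∑ j ∈ Finset.range N, q lam mu i j * f (st j) =
      gen lam mu f i := by
  have htri : ∑ j ∈ Finset.range (i + 2), q lam mu i j * f (st j) =
      ∑ j ∈ Finset.range N, q lam mu i j * f (st j) := by
    refine Finset.sum_subset (Finset.range_mono hN) fun j _ hj => ?_
    rw [q_eq_zero (.inl (by simpa using hj)), zero_mul]
  rw [← htri]
  cases i with
  | zero =>
    rw [if_pos rfl, Finset.sum_range_succ, Finset.sum_range_one, q_self, q_up, gen, down]
    ring
  | succ i =>
    rw [if_neg i.succ_ne_zero, Finset.sum_range_succ, Finset.sum_range_succ, Finset.sum_range_succ,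
      Finset.sum_eq_zero, q_down, q_self, q_up, gen, down]
    · ring
    · intro j hj
      rw [q_eq_zero (.inr (by have := Finset.mem_range.1 hj; omega)), zero_mul]

namespace IsTransitionFunction

theorem eq_zero_of_absorbing (hP : IsTransitionFunction lam mu P) {t : ℝ} (ht : 0 ≤ t)
    {x y : State} (hx : P t x x = 1) (hy : y ≠ x) : P t x y = 0 := by
  have h := sum_le_hasSum {x, y} (fun z _ => hP.nonneg t ht x z) (hP.hasSum_one t ht x)
  rw [Finset.sum_pair hy.symm, hx] at h
  exact le_antisymm (by linarith) (hP.nonneg t ht x y)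

theorem tsum_mul_of_absorbing (hP : IsTransitionFunction lam mu P) {t : ℝ} (ht : 0 ≤ t)
    {x : State} (hx : P t x x = 1) (w : State → ℝ≥0∞) :
    ∑' y, ENNReal.ofReal (P t x y) * w y = w x := by
  rw [tsum_eq_single x fun y hy => by simp [hP.eq_zero_of_absorbing ht hx hy], hx,
    ENNReal.ofReal_one, one_mul]

theorem hasSum_mul (hP : IsTransitionFunction lam mu P) {t : ℝ} (ht : 0 ≤ t) {f : State → ℝ}
    {N : ℕ} (hf : ∀ j, N ≤ j → f (st j) = f ⊤) (x : State) :
    HasSum (fun y => P t x y * f y)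
      (f ⊤ + (P t x ⊥ * (f ⊥ - f ⊤) + ∑ j ∈ Finset.range N, P t x (st j) * (f (st j) - f ⊤))) := by
  have hconst : HasSum (fun y => P t x y * f ⊤) (f ⊤) := by
    simpa using (hP.hasSum_one t ht x).mul_right (f ⊤)
  have hfin : HasSum (fun y => P t x y * (f y - f ⊤))
      (∑ y ∈ insert ⊥ ((Finset.range N).map ⟨st, st_injective⟩), P t x y * (f y - f ⊤)) := by
    refine hasSum_sum_of_ne_finset_zero fun y hy => ?_
    rcases state_cases y with rfl | rfl | ⟨j, rfl⟩
    · simp at hy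
    · simp
    · rw [hf j (by simpa using hy), sub_self, mul_zero]
  rw [Finset.sum_insert (by simp), Finset.sum_map] at hfin
  exact (hconst.add hfin).congr_fun fun y => by ring

theorem hasDerivWithinAt_st_zero (hP : IsTransitionFunction lam mu P) (i j : ℕ) :
    HasDerivWithinAt (fun t => P t (st i) (st j)) (q lam mu i j) (Set.Ici 0) 0 := by
  convert hP.backward 0 le_rfl i j using 1
  simp only [hP.zero, st_inj, mul_ite, mul_one, mul_zero, Finset.sum_ite_eq', Finset.mem_range]
  split_ifs with h
  · rfl
  · rw [q_eq_zero (.inl (by omega))]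

theorem hasDerivWithinAt_bot_zero (hP : IsTransitionFunction lam mu P) (i : ℕ) :
    HasDerivWithinAt (fun t => P t (st i) ⊥) (if i = 0 then mu 0 else 0) (Set.Ici 0) 0 := by
  simpa [hP.zero] using hP.evanescence 0 le_rfl i

theorem hasDerivWithinAt_tsum_zero (hP : IsTransitionFunction lam mu P) {f : State → ℝ}
    (hf : ∀ᶠ j in atTop, f (st j) = f ⊤) (i : ℕ) :
    HasDerivWithinAt (fun t => ∑' y, P t (st i) y * f y) (gen lam mu f i) (Set.Ici 0) 0 := by
  obtain ⟨N, hN⟩ := eventually_atTop.1 (hf.and (eventually_ge_atTop (i + 2)))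
  have hderiv := (((hP.hasDerivWithinAt_bot_zero i).mul_const (f ⊥ - f ⊤)).add
    (HasDerivWithinAt.fun_sum fun j (_ : j ∈ Finset.range N) =>
      (hP.hasDerivWithinAt_st_zero i j).mul_const (f (st j) - f ⊤))).const_add (f ⊤)
  rw [sum_q_mul (hN N le_rfl).2 fun y => f y - f ⊤] at hderiv
  simp only [gen, sub_sub_sub_cancel_right] at hderiv
  exact hderiv.congr_of_mem
    (fun t ht => (hP.hasSum_mul ht (fun j hj => (hN j hj).1) (st i)).tsum_eq) Set.self_mem_Ici

theorem eventually_tsum_mul_add_le (hP : IsTransitionFunction lam mu P) {f : State → ℝ}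
    (hf : ∀ᶠ j in atTop, f (st j) = f ⊤) {i : ℕ} {c : ℝ} (hc : gen lam mu f i < -c) :
    ∀ᶠ t in 𝓝[>] (0 : ℝ), ∑' y, P t (st i) y * f y + c * t ≤ f (st i) := by
  have hslope := (hP.hasDerivWithinAt_tsum_zero hf i).limsup_slope_le hc
  rw [Set.Ici_sdiff_left] at hslope
  filter_upwards [hslope, self_mem_nhdsWithin] with t ht (ht0 : 0 < t)
  have hstart : ∑' y, P 0 (st i) y * f y = f (st i) := by simp [hP.zero]
  rw [slope_def_field, hstart, sub_zero, div_lt_iff₀ ht0] at ht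
  linarith

theorem tsum_ofReal_mul_ofReal (hP : IsTransitionFunction lam mu P) {t : ℝ} (ht : 0 ≤ t)
    {f : State → ℝ} (hf0 : ∀ y, 0 ≤ f y) (hf : ∀ᶠ j in atTop, f (st j) = f ⊤) (x : State) :
    ∑' y, ENNReal.ofReal (P t x y) * ENNReal.ofReal (f y) =
      ENNReal.ofReal (∑' y, P t x y * f y) := by
  obtain ⟨N, hN⟩ := eventually_atTop.1 hf
  rw [ENNReal.ofReal_tsum_of_nonneg (fun y => mul_nonneg (hP.nonneg t ht x y) (hf0 y))
    (hP.hasSum_mul ht hN x).summable]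
  exact tsum_congr fun y => (ENNReal.ofReal_mul (hP.nonneg t ht x y)).symm

theorem eventually_tsum_ofReal_add_le (hP : IsTransitionFunction lam mu P) {f : State → ℝ}
    (hf0 : ∀ y, 0 ≤ f y) (hf : ∀ᶠ j in atTop, f (st j) = f ⊤) {I : Finset ℕ} {c : ℝ} (hc0 : 0 ≤ c)
    (hc : ∀ i ∈ I, gen lam mu f i < -c) :
    ∀ᶠ t in 𝓝[>] (0 : ℝ), ∀ i ∈ I,
      ∑' y, ENNReal.ofReal (P t (st i) y) * ENNReal.ofReal (f y) + ENNReal.ofReal (c * t) ≤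
        ENNReal.ofReal (f (st i)) := by
  refine I.eventually_all.2 fun i hi => ?_
  filter_upwards [hP.eventually_tsum_mul_add_le hf (hc i hi), self_mem_nhdsWithin] with t ht ht0
  have ht0 : 0 ≤ t := le_of_lt ht0
  rw [hP.tsum_ofReal_mul_ofReal ht0 hf0 hf, ← ENNReal.ofReal_add
    (tsum_nonneg fun y => mul_nonneg (hP.nonneg t ht0 _ y) (hf0 y)) (mul_nonneg hc0 ht0)]
  exact ENNReal.ofReal_le_ofReal ht

end IsTransitionFunction

end Generator

section ExitTime

variable {lam mu : ℕ → ℝ}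

/-- The mean time to go from `i` to `i + 1` when `μ₀` is replaced by zero. -/
noncomputable def stepTime (lam mu : ℕ → ℝ) : ℕ → ℝ
  | 0 => 1 / lam 0
  | i + 1 => (1 + mu (i + 1) * stepTime lam mu i) / lam (i + 1)

theorem stepTime_pos (hlam : ∀ i, 0 < lam i) (hmu : ∀ i, 1 ≤ i → 0 < mu i) (i : ℕ) :
    0 < stepTime lam mu i := by
  induction i with
  | zero => exact one_div_pos.2 (hlam 0)
  | succ i ih =>
    have := hmu (i + 1) (by omega)
    exact div_pos (by positivity) (hlam _)

/-- The mean time to go from a state to `N` when `μ₀` is replaced by zero, extended by `0` to the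
states above `N` and to the absorbing states. -/
noncomputable def exitTime (lam mu : ℕ → ℝ) (N : ℕ) : State → ℝ :=
  extend 0 (fun i => ∑ k ∈ Finset.Ico i N, stepTime lam mu k) 0

theorem exitTime_st_nonneg (hlam : ∀ i, 0 < lam i) (hmu : ∀ i, 1 ≤ i → 0 < mu i) (N i : ℕ) :
    0 ≤ exitTime lam mu N (st i) := by
  rw [exitTime, extend_st]
  exact Finset.sum_nonneg fun k _ => (stepTime_pos hlam hmu k).le

theorem exitTime_nonneg (hlam : ∀ i, 0 < lam i) (hmu : ∀ i, 1 ≤ i → 0 < mu i) (N : ℕ) (x : State) :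
    0 ≤ exitTime lam mu N x := by
  rcases state_cases x with rfl | rfl | ⟨i, rfl⟩
  exacts [le_rfl, le_rfl, exitTime_st_nonneg hlam hmu N i]

theorem exitTime_eq_add {N i : ℕ} (h : i < N) :
    exitTime lam mu N (st i) = stepTime lam mu i + exitTime lam mu N (st (i + 1)) :=
  Finset.sum_eq_sum_Ico_succ_bot h _

theorem exitTime_eq_zero {N i : ℕ} (h : N ≤ i) : exitTime lam mu N (st i) = 0 := by
  simp [exitTime, h]

theorem gen_exitTime_le (hlam : ∀ i, 0 < lam i) (hmu : ∀ i, 1 ≤ i → 0 < mu i) (hmu0 : 0 ≤ mu 0)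
    {N i : ℕ} (h : i < N) : gen lam mu (exitTime lam mu N) i ≤ -1 := by
  have hne := (hlam i).ne'
  cases i with
  | zero =>
    have hstep : lam 0 * stepTime lam mu 0 = 1 := mul_div_cancel₀ _ hne
    have hkill : 0 ≤ mu 0 * exitTime lam mu N (st 0) :=
      mul_nonneg hmu0 (exitTime_st_nonneg hlam hmu N 0)
    have hbot : exitTime lam mu N (down 0) = 0 := rfl
    rw [gen, hbot]
    linear_combination hkill - hstep - lam 0 * exitTime_eq_add (lam := lam) (mu := mu) h
  | succ i =>
    have hstep : lam (i + 1) * stepTime lam mu (i + 1) = 1 + mu (i + 1) * stepTime lam mu i :=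
      mul_div_cancel₀ _ hne
    rw [gen, down, exitTime_eq_add h, exitTime_eq_add (i.lt_succ_self.trans h), exitTime_eq_add h]
    linear_combination -hstep

end ExitTime

section Superharmonic

variable {lam mu : ℕ → ℝ} {P : ℝ → State → State → ℝ} {Ω : Type*} [MeasurableSpace Ω]
  {X : ℝ≥0 → Ω → State} {Pr : Measure Ω} {f : State → ℝ} {I : Finset ℕ} {i₀ z : ℕ}

theorem gen_add_mul (f g : State → ℝ) (ε : ℝ) (i : ℕ) :
    gen lam mu (fun y => f y + ε * g y) i = gen lam mu f i + ε * gen lam mu g i := by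
  simp only [gen]
  ring

theorem IsTransitionFunction.eventually_tsum_perturbed_add_le (hlam : ∀ i, 0 < lam i)
    (hmu : ∀ i, 1 ≤ i → 0 < mu i) (hmu0 : 0 ≤ mu 0) (hP : IsTransitionFunction lam mu P)
    (hf0 : ∀ y, 0 ≤ f y) (hf : ∀ᶠ j in atTop, f (st j) = f ⊤) (hgen : ∀ i ∈ I, gen lam mu f i ≤ 0)
    {N : ℕ} (hN : I ⊆ Finset.range N) {ε : ℝ} (hε : 0 < ε) :
    ∀ᶠ t in 𝓝[>] (0 : ℝ), ∀ i ∈ I,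
      ∑' y, ENNReal.ofReal (P t (st i) y) * ENNReal.ofReal (f y + ε * exitTime lam mu N y) +
          ENNReal.ofReal (ε / 2 * t) ≤
        ENNReal.ofReal (f (st i) + ε * exitTime lam mu N (st i)) := by
  refine hP.eventually_tsum_ofReal_add_le (f := fun y => f y + ε * exitTime lam mu N y)
    (fun y => add_nonneg (hf0 y) (mul_nonneg hε.le (exitTime_nonneg hlam hmu N y))) ?_
    (half_pos hε).le fun i hi => ?_
  · filter_upwards [hf, eventually_ge_atTop N] with j hj hNj
    rw [hj, exitTime_eq_zero hNj]
    rfl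
  · have hexit := mul_le_mul_of_nonneg_left
      (gen_exitTime_le hlam hmu hmu0 (Finset.mem_range.1 (hN hi))) hε.le
    rw [gen_add_mul]
    linarith [hgen i hi]

theorem le_ofReal_of_forall_pos {p : ℝ≥0∞} {a b : ℝ}
    (h : ∀ ε > 0, p ≤ ENNReal.ofReal (a + ε * b)) : p ≤ ENNReal.ofReal a := by
  have hcont : Continuous fun ε : ℝ => ENNReal.ofReal (a + ε * b) :=
    ENNReal.continuous_ofReal.comp (by fun_prop)
  have hlim := (hcont.tendsto 0).mono_left (nhdsWithin_le_nhds (s := Set.Ioi 0))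
  rw [zero_mul, add_zero] at hlim
  exact ge_of_tendsto hlim (eventually_mem_nhdsWithin.mono h)

theorem measure_hitTime_lt_top_le_of_gen_nonpos (hlam : ∀ i, 0 < lam i)
    (hmu : ∀ i, 1 ≤ i → 0 < mu i) (hmu0 : 0 ≤ mu 0) (hP : IsTransitionFunction lam mu P)
    (hX : IsMarkovChainFrom P (st i₀) X Pr) (hz : z ∉ I) (hf0 : ∀ y, 0 ≤ f y)
    (hf : ∀ᶠ j in atTop, f (st j) = f ⊤) (hgen : ∀ i ∈ I, gen lam mu f i ≤ 0)
    (hI : ∀ j ∉ I, 1 ≤ f (st j)) :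
    Pr {ω | hitTime X z ω < ⊤} ≤ ENNReal.ofReal (f (st i₀)) := by
  obtain ⟨N, hN⟩ := I.exists_nat_subset_range
  refine le_ofReal_of_forall_pos (b := exitTime lam mu N (st i₀)) fun ε hε => ?_
  refine hX.measure_hitTime_lt_top_le (B := st '' (↑I)ᶜ)
    (w := fun y => ENNReal.ofReal (f y + ε * exitTime lam mu N y)) ⟨z, hz, rfl⟩ ?_ ?_
  · filter_upwards [hP.eventually_tsum_perturbed_add_le hlam hmu hmu0 hf0 hf hgen hN hε,
      self_mem_nhdsWithin] with t ht (ht0 : 0 < t) y hy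
    rcases state_cases y with rfl | rfl | ⟨i, rfl⟩
    · exact (hP.tsum_mul_of_absorbing ht0.le (hP.absorbing_bot t ht0.le) _).le
    · exact (hP.tsum_mul_of_absorbing ht0.le (hP.absorbing_top t ht0.le) _).le
    · exact le_self_add.trans (ht i (by simpa using hy))
  · rintro _ ⟨j, hj, rfl⟩
    exact ENNReal.one_le_ofReal.2
      (le_add_of_le_of_nonneg (hI j hj) (mul_nonneg hε.le (exitTime_st_nonneg hlam hmu N j)))

theorem measure_hitTime_eq_top_le_of_gen_nonpos (hlam : ∀ i, 0 < lam i)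
    (hmu : ∀ i, 1 ≤ i → 0 < mu i) (hmu0 : 0 ≤ mu 0) (hP : IsTransitionFunction lam mu P)
    (hX : IsMarkovChainFrom P (st i₀) X Pr) (hf0 : ∀ y, 0 ≤ f y)
    (hf : ∀ᶠ j in atTop, f (st j) = f ⊤) (hgen : ∀ i ∈ I, gen lam mu f i ≤ 0)
    (hI : ∀ y ∉ st '' I, y ≠ st z → 1 ≤ f y) :
    Pr {ω | hitTime X z ω = ⊤} ≤ ENNReal.ofReal (f (st i₀)) := by
  obtain ⟨N, hN⟩ := I.exists_nat_subset_range
  refine le_ofReal_of_forall_pos (b := exitTime lam mu N (st i₀)) fun ε hε => ?_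
  obtain ⟨t, ht, ht0⟩ := ((hP.eventually_tsum_perturbed_add_le hlam hmu hmu0 hf0 hf hgen hN hε).and
    self_mem_nhdsWithin).exists
  lift t to ℝ≥0 using le_of_lt ht0
  refine hX.measure_hitTime_eq_top_le (A := st '' I) (s := t)
    (w := fun y => ENNReal.ofReal (f y + ε * exitTime lam mu N y))
    (ENNReal.ofReal_pos.2 (mul_pos (half_pos hε) ht0)).ne' ?_ fun y hy hyz => ?_
  · rintro _ ⟨i, hi, rfl⟩
    exact ht i hi
  · exact ENNReal.one_le_ofReal.2
      (le_add_of_le_of_nonneg (hI y hy hyz) (mul_nonneg hε.le (exitTime_nonneg hlam hmu N y)))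

end Superharmonic

section Scale

variable {lam mu : ℕ → ℝ}

theorem piCoeff_zero (lam mu : ℕ → ℝ) : piCoeff lam mu 0 = 1 := by simp [piCoeff]

theorem piCoeff_pos (hlam : ∀ i, 0 < lam i) (hmu : ∀ i, 1 ≤ i → 0 < mu i) (n : ℕ) :
    0 < piCoeff lam mu n :=
  div_pos (Finset.prod_pos fun i _ => hlam i) (Finset.prod_pos fun i _ => hmu _ (by omega))

theorem mu_mul_piCoeff_succ (hmu : ∀ i, 1 ≤ i → 0 < mu i) (n : ℕ) :
    mu (n + 1) * piCoeff lam mu (n + 1) = lam n * piCoeff lam mu n := by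
  have hne := (hmu (n + 1) (by omega)).ne'
  have hprod : ∏ i ∈ Finset.range n, mu (i + 1) ≠ 0 :=
    (Finset.prod_pos fun i _ => hmu (i + 1) (by omega)).ne'
  rw [piCoeff, piCoeff, Finset.prod_range_succ, Finset.prod_range_succ]
  field_simp

theorem inv_lam_mul_piCoeff_pos (hlam : ∀ i, 0 < lam i) (hmu : ∀ i, 1 ≤ i → 0 < mu i) (n : ℕ) :
    0 < (lam n * piCoeff lam mu n)⁻¹ :=
  inv_pos.2 (mul_pos (hlam n) (piCoeff_pos hlam hmu n))

theorem lam_mul_inv_succ (hlam : ∀ i, 0 < lam i) (hmu : ∀ i, 1 ≤ i → 0 < mu i) (n : ℕ) :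
    lam (n + 1) * (lam (n + 1) * piCoeff lam mu (n + 1))⁻¹ =
      mu (n + 1) * (lam n * piCoeff lam mu n)⁻¹ := by
  have hmu_ne := (hmu (n + 1) (by omega)).ne'
  have hlam_ne := (hlam (n + 1)).ne'
  have hpi_ne := (piCoeff_pos hlam hmu (n + 1)).ne'
  rw [← mu_mul_piCoeff_succ hmu n]
  field_simp

/-- The scale function `(λ₀π₀)⁻¹ + ⋯ + (λₙ₋₁πₙ₋₁)⁻¹` of the birth-death process, which is `Lₙ₋₁`
for `n ≥ 1`. -/
noncomputable def scale (lam mu : ℕ → ℝ) (n : ℕ) : ℝ :=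
  ∑ i ∈ Finset.range n, (lam i * piCoeff lam mu i)⁻¹

theorem L_sub_one {n : ℕ} (hn : 1 ≤ n) : L lam mu (n - 1) = scale lam mu n := by
  rw [L, scale, Nat.sub_add_cancel hn]

theorem scale_zero (lam mu : ℕ → ℝ) : scale lam mu 0 = 0 := by simp [scale]

theorem scale_succ (lam mu : ℕ → ℝ) (n : ℕ) :
    scale lam mu (n + 1) = scale lam mu n + (lam n * piCoeff lam mu n)⁻¹ :=
  Finset.sum_range_succ _ _

theorem scale_strictMono (hlam : ∀ i, 0 < lam i) (hmu : ∀ i, 1 ≤ i → 0 < mu i) :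
    StrictMono (scale lam mu) :=
  strictMono_nat_of_lt_succ fun n => by
    rw [scale_succ]
    linarith [inv_lam_mul_piCoeff_pos hlam hmu n]

theorem scale_nonneg (hlam : ∀ i, 0 < lam i) (hmu : ∀ i, 1 ≤ i → 0 < mu i) (n : ℕ) :
    0 ≤ scale lam mu n :=
  Finset.sum_nonneg fun i _ => (inv_lam_mul_piCoeff_pos hlam hmu i).le

theorem tendsto_ofReal_scale (hlam : ∀ i, 0 < lam i) (hmu : ∀ i, 1 ≤ i → 0 < mu i) :
    Tendsto (fun n => ENNReal.ofReal (scale lam mu n)) atTop (𝓝 (LInf lam mu)) := by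
  refine (ENNReal.tendsto_nat_tsum fun i => ENNReal.ofReal (lam i * piCoeff lam mu i)⁻¹).congr
    fun n => ?_
  rw [scale, ENNReal.ofReal_sum_of_nonneg fun i _ => (inv_lam_mul_piCoeff_pos hlam hmu i).le]

variable {f : State → ℝ} {a b : ℝ}

theorem gen_succ_of_affine_scale (hlam : ∀ i, 0 < lam i) (hmu : ∀ i, 1 ≤ i → 0 < mu i) {i : ℕ}
    (hf : ∀ j ≤ i + 2, f (st j) = a + b * scale lam mu j) : gen lam mu f (i + 1) = 0 := by
  rw [gen, down, hf _ le_rfl, hf (i + 1) (by omega), hf i (by omega), scale_succ lam mu (i + 1),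
    scale_succ lam mu i]
  linear_combination b * lam_mul_inv_succ hlam hmu i

theorem gen_zero_of_affine_scale (hlam : ∀ i, 0 < lam i)
    (hf : ∀ j ≤ 1, f (st j) = a + b * scale lam mu j) :
    gen lam mu f 0 = b + mu 0 * (f ⊥ - a) := by
  have hinv : lam 0 * (lam 0 * piCoeff lam mu 0)⁻¹ = 1 := by
    rw [piCoeff_zero, mul_one, mul_inv_cancel₀ (hlam 0).ne']
  rw [gen, down, hf _ le_rfl, hf 0 zero_le_one, scale_succ, scale_zero]
  linear_combination b * hinv

theorem gen_of_affine_scale (hlam : ∀ i, 0 < lam i) (hmu : ∀ i, 1 ≤ i → 0 < mu i) {i : ℕ}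
    (hf : ∀ j ≤ i + 1, f (st j) = a + b * scale lam mu j) (h0 : b + mu 0 * (f ⊥ - a) = 0) :
    gen lam mu f i = 0 := by
  cases i with
  | zero => rw [gen_zero_of_affine_scale hlam hf, h0]
  | succ i => exact gen_succ_of_affine_scale hlam hmu hf

end Scale

section HittingProbability

variable {lam mu : ℕ → ℝ} {P : ℝ → State → State → ℝ} {Ω : Type*} [MeasurableSpace Ω]
  {X : ℝ≥0 → Ω → State} {Pr : Measure Ω} {n : ℕ}

theorem one_add_mul_scale_pos (hlam : ∀ i, 0 < lam i) (hmu : ∀ i, 1 ≤ i → 0 < mu i)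
    (hmu0 : 0 ≤ mu 0) (n : ℕ) : 0 < 1 + mu 0 * scale lam mu n :=
  add_pos_of_pos_of_nonneg one_pos (mul_nonneg hmu0 (scale_nonneg hlam hmu n))

theorem one_add_mul_scale_mono (hlam : ∀ i, 0 < lam i) (hmu : ∀ i, 1 ≤ i → 0 < mu i)
    (hmu0 : 0 ≤ mu 0) : Monotone fun n => 1 + mu 0 * scale lam mu n := fun _ _ h =>
  add_le_add_right (mul_le_mul_of_nonneg_left ((scale_strictMono hlam hmu).monotone h) hmu0) _

theorem measure_hitTime_lt_top_le_of_zero (hlam : ∀ i, 0 < lam i) (hmu : ∀ i, 1 ≤ i → 0 < mu i)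
    (hmu0 : 0 ≤ mu 0) (hP : IsTransitionFunction lam mu P)
    (hX : IsMarkovChainFrom P (st 0) X Pr) :
    Pr {ω | hitTime X n ω < ⊤} ≤ ENNReal.ofReal (1 / (1 + mu 0 * scale lam mu n)) := by
  set s : ℕ → ℝ := fun j => 1 + mu 0 * scale lam mu j with hs
  have hs_pos : ∀ j, 0 < s j := one_add_mul_scale_pos hlam hmu hmu0
  have hs_mono : Monotone s := one_add_mul_scale_mono hlam hmu hmu0
  have hquot (j : ℕ) : 0 < s j / s n := div_pos (hs_pos j) (hs_pos n)
  have htop (j : ℕ) (hj : n ≤ j) : min (s j / s n) 1 = 1 :=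
    min_eq_right ((one_le_div (hs_pos n)).2 (hs_mono hj))
  refine (measure_hitTime_lt_top_le_of_gen_nonpos hlam hmu hmu0 hP hX (I := Finset.range n)
    (f := extend 0 (fun j => min (s j / s n) 1) 1) (by simp) (fun y => ?_) ?_ (fun i hi => ?_)
    fun j hj => (htop j (by simpa using hj)).ge).trans ?_
  · rcases state_cases y with rfl | rfl | ⟨j, rfl⟩
    exacts [le_rfl, zero_le_one, le_min (hquot j).le zero_le_one]
  · filter_upwards [eventually_ge_atTop n] with j hj using htop j hj
  · refine (gen_of_affine_scale hlam hmu (a := 1 / s n) (b := mu 0 / s n) (fun j hj => ?_) ?_).le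
    · have hjn : j ≤ n := hj.trans (Finset.mem_range.1 hi)
      rw [extend_st, min_eq_left ((div_le_one (hs_pos n)).2 (hs_mono hjn))]
      ring
    · rw [extend_bot]
      ring
  · refine ENNReal.ofReal_le_ofReal ((min_le_left _ _).trans_eq ?_)
    simp [hs, scale_zero]

theorem measure_hitTime_eq_top_le_of_zero (hlam : ∀ i, 0 < lam i) (hmu : ∀ i, 1 ≤ i → 0 < mu i)
    (hmu0 : 0 ≤ mu 0) (hP : IsTransitionFunction lam mu P)
    (hX : IsMarkovChainFrom P (st 0) X Pr) :
    Pr {ω | hitTime X n ω = ⊤} ≤ ENNReal.ofReal (1 - 1 / (1 + mu 0 * scale lam mu n)) := by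
  set s : ℕ → ℝ := fun j => 1 + mu 0 * scale lam mu j with hs
  have hs_pos : ∀ j, 0 < s j := one_add_mul_scale_pos hlam hmu hmu0
  have hs_mono : Monotone s := one_add_mul_scale_mono hlam hmu hmu0
  refine (measure_hitTime_eq_top_le_of_gen_nonpos hlam hmu hmu0 hP hX (I := Finset.range n)
    (f := extend 1 (fun j => if j ≤ n then 1 - s j / s n else 1) 1) (fun y => ?_) ?_
    (fun i hi => ?_) fun y hy hyn => ?_).trans_eq ?_
  · rcases state_cases y with rfl | rfl | ⟨j, rfl⟩
    · exact zero_le_one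
    · exact zero_le_one
    · rw [extend_st]
      split_ifs with hj
      exacts [sub_nonneg.2 ((div_le_one (hs_pos n)).2 (hs_mono hj)), zero_le_one]
  · filter_upwards [eventually_gt_atTop n] with j hj using if_neg hj.not_ge
  · refine (gen_of_affine_scale hlam hmu (a := 1 - 1 / s n) (b := -(mu 0 / s n))
      (fun j hj => ?_) ?_).le
    · rw [extend_st, if_pos (hj.trans (Finset.mem_range.1 hi))]
      ring
    · rw [extend_bot]
      ring
  · rcases state_cases y with rfl | rfl | ⟨j, rfl⟩
    · exact le_rfl
    · exact le_rfl
    · have hnj : n ≤ j := by simpa using hy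
      exact (if_neg (hnj.lt_of_ne fun h => hyn (h ▸ rfl)).not_ge).ge
  · simp [hs, scale_zero]

theorem measure_hitTime_lt_top_of_zero (hlam : ∀ i, 0 < lam i) (hmu : ∀ i, 1 ≤ i → 0 < mu i)
    (hmu0 : 0 ≤ mu 0) (hP : IsTransitionFunction lam mu P)
    (hX : IsMarkovChainFrom P (st 0) X Pr) :
    Pr {ω | hitTime X n ω < ⊤} = ENNReal.ofReal (1 / (1 + mu 0 * scale lam mu n)) := by
  have := hX.isProbabilityMeasure
  refine (measure_hitTime_lt_top_le_of_zero hlam hmu hmu0 hP hX).antisymm ?_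
  have hle : 1 / (1 + mu 0 * scale lam mu n) ≤ 1 :=
    (div_le_one (one_add_mul_scale_pos hlam hmu hmu0 n)).2
      (le_add_of_nonneg_right (mul_nonneg hmu0 (scale_nonneg hlam hmu n)))
  calc ENNReal.ofReal (1 / (1 + mu 0 * scale lam mu n))
      = 1 - ENNReal.ofReal (1 - 1 / (1 + mu 0 * scale lam mu n)) := by
        rw [← ENNReal.ofReal_one, ← ENNReal.ofReal_sub _ (sub_nonneg.2 hle), sub_sub_cancel]
    _ ≤ Pr {ω | hitTime X n ω < ⊤} :=
        one_sub_le_measure_hitTime_lt_top (measure_hitTime_eq_top_le_of_zero hlam hmu hmu0 hP hX)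

theorem measure_hitTime_zero_eq_top_le_of_lt (hlam : ∀ i, 0 < lam i)
    (hmu : ∀ i, 1 ≤ i → 0 < mu i) (hmu0 : 0 ≤ mu 0) (hP : IsTransitionFunction lam mu P) {N : ℕ}
    (hN : n < N) (hX : IsMarkovChainFrom P (st n) X Pr) :
    Pr {ω | hitTime X 0 ω = ⊤} ≤
      ENNReal.ofReal (scale lam mu n) / ENNReal.ofReal (scale lam mu N) := by
  have hmono := (scale_strictMono hlam hmu).monotone
  have hN0 : 0 < scale lam mu N := (scale_nonneg hlam hmu n).trans_lt (scale_strictMono hlam hmu hN)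
  have htop (j : ℕ) (hj : N ≤ j) : min (scale lam mu j / scale lam mu N) 1 = 1 :=
    min_eq_right ((one_le_div hN0).2 (hmono hj))
  rw [← ENNReal.ofReal_div_of_pos hN0]
  refine (measure_hitTime_eq_top_le_of_gen_nonpos hlam hmu hmu0 hP hX (I := Finset.Ico 1 N)
    (f := extend 1 (fun j => min (scale lam mu j / scale lam mu N) 1) 1) (fun y => ?_) ?_
    (fun i hi => ?_) fun y hy hy0 => ?_).trans (ENNReal.ofReal_le_ofReal (min_le_left _ _))
  · rcases state_cases y with rfl | rfl | ⟨j, rfl⟩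
    exacts [zero_le_one, zero_le_one,
      le_min (div_nonneg (scale_nonneg hlam hmu j) hN0.le) zero_le_one]
  · filter_upwards [eventually_ge_atTop N] with j hj using htop j hj
  · obtain ⟨hi1, hiN⟩ := Finset.mem_Ico.1 hi
    obtain ⟨i, rfl⟩ := Nat.exists_eq_add_of_le' hi1
    refine (gen_succ_of_affine_scale hlam hmu (a := 0) (b := (scale lam mu N)⁻¹) fun j hj => ?_).le
    rw [extend_st, min_eq_left ((div_le_one hN0).2 (hmono (hj.trans hiN)))]
    ring
  · rcases state_cases y with rfl | rfl | ⟨j, rfl⟩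
    · exact le_rfl
    · exact le_rfl
    · have hj : j ∉ Finset.Ico 1 N := by simpa using hy
      have hj0 : j ≠ 0 := fun h => hy0 (h ▸ rfl)
      exact (htop j (by rw [Finset.mem_Ico] at hj; omega)).ge

theorem one_sub_le_measure_hitTime_zero (hlam : ∀ i, 0 < lam i) (hmu : ∀ i, 1 ≤ i → 0 < mu i)
    (hmu0 : 0 ≤ mu 0) (hP : IsTransitionFunction lam mu P)
    (hX : IsMarkovChainFrom P (st n) X Pr) :
    1 - ENNReal.ofReal (scale lam mu n) / LInf lam mu ≤ Pr {ω | hitTime X 0 ω < ⊤} := by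
  have := hX.isProbabilityMeasure
  have hlim := ENNReal.Tendsto.const_div (a := ENNReal.ofReal (scale lam mu n))
    (tendsto_ofReal_scale hlam hmu) (.inr ENNReal.ofReal_ne_top)
  refine one_sub_le_measure_hitTime_lt_top (ge_of_tendsto hlim ?_)
  filter_upwards [eventually_gt_atTop n] with N hN
    using measure_hitTime_zero_eq_top_le_of_lt hlam hmu hmu0 hP hN hX

end HittingProbability

section ForwardFlux

variable {lam mu : ℕ → ℝ} {P : ℝ → State → State → ℝ} {t : ℝ}

theorem sum_mul_q_succ (x : ℕ → ℝ) (j : ℕ) :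
    ∑ k ∈ Finset.range (j + 3), x k * q lam mu k (j + 1) =
      x j * lam j - x (j + 1) * (lam (j + 1) + mu (j + 1)) + x (j + 2) * mu (j + 2) := by
  rw [Finset.sum_range_succ, Finset.sum_range_succ, Finset.sum_range_succ, Finset.sum_eq_zero,
    q_up, q_self, q_down]
  · ring
  · intro k hk
    rw [q_eq_zero (.inl (by have := Finset.mem_range.1 hk; omega)), mul_zero]

theorem sum_sum_mul_q_mul (x : ℕ → ℝ) {f : State → ℝ} (hf : f ⊥ = 0) (M : ℕ) :
    ∑ j ∈ Finset.range (M + 1), (∑ k ∈ Finset.range (j + 2), x k * q lam mu k j) * f (st j) =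
      ∑ j ∈ Finset.range (M + 1), gen lam mu f j * x j +
        (mu (M + 1) * f (st M) * x (M + 1) - lam M * f (st (M + 1)) * x M) := by
  induction M with
  | zero =>
    rw [Finset.sum_range_one, Finset.sum_range_one, Finset.sum_range_succ, Finset.sum_range_one,
      q_self, q_down, gen, down, hf]
    ring
  | succ M ih =>
    rw [Finset.sum_range_succ, ih, sum_mul_q_succ, Finset.sum_range_succ _ (M + 1), gen, down]
    ring

namespace IsTransitionFunction

theorem intervalIntegrable (hP : IsTransitionFunction lam mu P) (ht : 0 ≤ t) (i j : ℕ) :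
    IntervalIntegrable (fun u => P u (st i) (st j)) volume 0 t := by
  refine ContinuousOn.intervalIntegrable_of_Icc ht fun u hu => ?_
  exact (hP.forward u hu.1 i j).continuousWithinAt.mono Set.Icc_subset_Ici_self

theorem sum_st_le_one (hP : IsTransitionFunction lam mu P) (ht : 0 ≤ t) (x : State) (M : ℕ) :
    ∑ j ∈ Finset.range M, P t x (st j) ≤ 1 := by
  have h := sum_le_hasSum ((Finset.range M).map ⟨st, st_injective⟩)
    (fun y _ => hP.nonneg t ht x y) (hP.hasSum_one t ht x)
  simpa using h

end IsTransitionFunction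

/-- The expected time spent in `j` up to time `t` when starting from `i`. -/
noncomputable def occupation (P : ℝ → State → State → ℝ) (t : ℝ) (i j : ℕ) : ℝ :=
  ∫ u in (0 : ℝ)..t, P u (st i) (st j)

namespace IsTransitionFunction

theorem occupation_nonneg (hP : IsTransitionFunction lam mu P) (ht : 0 ≤ t) (i j : ℕ) :
    0 ≤ occupation P t i j :=
  intervalIntegral.integral_nonneg ht fun u hu => hP.nonneg u hu.1 _ _

theorem summable_occupation (hP : IsTransitionFunction lam mu P) (ht : 0 ≤ t) (i : ℕ) :
    Summable (occupation P t i) := by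
  refine summable_of_sum_range_le (c := t) (hP.occupation_nonneg ht i) fun M => ?_
  have hint (j : ℕ) (_ : j ∈ Finset.range M) := hP.intervalIntegrable ht i j
  calc ∑ j ∈ Finset.range M, occupation P t i j
      = ∫ u in (0 : ℝ)..t, ∑ j ∈ Finset.range M, P u (st i) (st j) :=
        (intervalIntegral.integral_finsetSum hint).symm
    _ ≤ ∫ _ in (0 : ℝ)..t, (1 : ℝ) := by
        refine intervalIntegral.integral_mono_on ht ?_ intervalIntegrable_const
          fun u hu => hP.sum_st_le_one hu.1 _ _
        rw [← Finset.sum_fn]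
        exact IntervalIntegrable.sum _ hint
    _ = t := by simp

theorem sum_mul_le_add_flux (hP : IsTransitionFunction lam mu P) {f : State → ℝ} (hf : f ⊥ = 0)
    (hgen : ∀ j, gen lam mu f j ≤ 0) (ht : 0 ≤ t) {i M : ℕ} (hiM : i ≤ M) :
    ∑ j ∈ Finset.range (M + 1), P t (st i) (st j) * f (st j) ≤
      f (st i) + (mu (M + 1) * f (st M) * occupation P t i (M + 1) -
        lam M * f (st (M + 1)) * occupation P t i M) := by
  set F : ℝ → ℝ := fun u => ∑ j ∈ Finset.range (M + 1), P u (st i) (st j) * f (st j) with hF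
  set flux : ℝ → ℝ := fun u => mu (M + 1) * f (st M) * P u (st i) (st (M + 1)) -
    lam M * f (st (M + 1)) * P u (st i) (st M)
  have hderiv (u : ℝ) (hu : 0 ≤ u) : HasDerivWithinAt F
      (∑ j ∈ Finset.range (M + 1), gen lam mu f j * P u (st i) (st j) + flux u) (Set.Ici 0) u := by
    have h := HasDerivWithinAt.fun_sum fun j (_ : j ∈ Finset.range (M + 1)) =>
      (hP.forward u hu i j).mul_const (f (st j))
    rwa [sum_sum_mul_q_mul (fun k => P u (st i) (st k)) hf M] at h
  have hint (c : ℝ) (j : ℕ) : IntervalIntegrable (fun u => c * P u (st i) (st j)) volume 0 t :=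
    (hP.intervalIntegrable ht i j).const_mul c
  have hflux_int : IntervalIntegrable flux volume 0 t := (hint _ _).sub (hint _ _)
  have hF_le : F t - F 0 ≤ ∫ u in (0 : ℝ)..t, flux u := by
    refine intervalIntegral.sub_le_integral_of_hasDeriv_right_of_le ht
      (fun u hu => (hderiv u hu.1).continuousWithinAt.mono Set.Icc_subset_Ici_self)
      (fun u hu => (hderiv u hu.1.le).mono fun v hv => hu.1.le.trans (le_of_lt hv))
      ((intervalIntegrable_iff_integrableOn_Icc_of_le ht).1 hflux_int) fun u hu => ?_
    exact add_le_of_nonpos_left (Finset.sum_nonpos fun j _ =>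
      mul_nonpos_of_nonpos_of_nonneg (hgen j) (hP.nonneg u hu.1.le _ _))
  have hF0 : F 0 = f (st i) := by
    simp [hF, hP.zero, Nat.lt_succ_of_le hiM]
  have hflux_eq : ∫ u in (0 : ℝ)..t, flux u = mu (M + 1) * f (st M) * occupation P t i (M + 1) -
      lam M * f (st (M + 1)) * occupation P t i M := by
    rw [intervalIntegral.integral_sub (hint _ _) (hint _ _), intervalIntegral.integral_const_mul,
      intervalIntegral.integral_const_mul, occupation, occupation]
  linarith

end IsTransitionFunction

end ForwardFlux

section ScaleTail

variable {lam mu : ℕ → ℝ}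

/-- The tail `∑_{k ≥ n} (λₖπₖ)⁻¹` of the series defining `L_∞`, to be used when that series
converges. -/
noncomputable def scaleTail (lam mu : ℕ → ℝ) (n : ℕ) : ℝ :=
  ∑' i, (lam i * piCoeff lam mu i)⁻¹ - scale lam mu n

theorem scaleTail_sub_succ (lam mu : ℕ → ℝ) (n : ℕ) :
    scaleTail lam mu n - scaleTail lam mu (n + 1) = (lam n * piCoeff lam mu n)⁻¹ := by
  rw [scaleTail, scaleTail, scale_succ]
  ring

theorem tendsto_scaleTail (hs : Summable fun i => (lam i * piCoeff lam mu i)⁻¹) :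
    Tendsto (scaleTail lam mu) atTop (𝓝 0) := by
  have h := hs.hasSum.tendsto_sum_nat.const_sub (∑' i, (lam i * piCoeff lam mu i)⁻¹)
  rwa [sub_self] at h

theorem scaleTail_pos (hlam : ∀ i, 0 < lam i) (hmu : ∀ i, 1 ≤ i → 0 < mu i)
    (hs : Summable fun i => (lam i * piCoeff lam mu i)⁻¹) (n : ℕ) : 0 < scaleTail lam mu n :=
  sub_pos.2 <| (scale_strictMono hlam hmu n.lt_succ_self).trans_le <|
    hs.sum_le_tsum _ fun i _ => (inv_lam_mul_piCoeff_pos hlam hmu i).le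

theorem gen_extend_scaleTail_nonpos (hlam : ∀ i, 0 < lam i) (hmu : ∀ i, 1 ≤ i → 0 < mu i)
    (hmu0 : 0 ≤ mu 0) (i : ℕ) : gen lam mu (extend 0 (scaleTail lam mu) 0) i ≤ 0 := by
  set S := ∑' i, (lam i * piCoeff lam mu i)⁻¹
  have haffine (j : ℕ) : extend 0 (scaleTail lam mu) 0 (st j) = S + -1 * scale lam mu j := by
    rw [extend_st, scaleTail, neg_one_mul, sub_eq_add_neg]
  cases i with
  | zero =>
    have hkill : 0 ≤ mu 0 * S :=
      mul_nonneg hmu0 (tsum_nonneg fun i => (inv_lam_mul_piCoeff_pos hlam hmu i).le)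
    rw [gen_zero_of_affine_scale hlam fun j _ => haffine j, extend_bot]
    linarith
  | succ i => exact (gen_succ_of_affine_scale hlam hmu fun j _ => haffine j).le

theorem ofReal_scaleTail_div (hlam : ∀ i, 0 < lam i) (hmu : ∀ i, 1 ≤ i → 0 < mu i)
    (hs : Summable fun i => (lam i * piCoeff lam mu i)⁻¹) (n : ℕ) :
    ENNReal.ofReal (scaleTail lam mu n / scaleTail lam mu 0) =
      1 - ENNReal.ofReal (scale lam mu n) / LInf lam mu := by
  have hpos := scaleTail_pos hlam hmu hs 0
  have htail : scaleTail lam mu n = scaleTail lam mu 0 - scale lam mu n := by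
    rw [scaleTail, scaleTail, scale_zero, sub_zero]
  have hLInf : LInf lam mu = ENNReal.ofReal (scaleTail lam mu 0) := by
    rw [LInf, ← ENNReal.ofReal_tsum_of_nonneg
      (fun i => (inv_lam_mul_piCoeff_pos hlam hmu i).le) hs, scaleTail, scale_zero, sub_zero]
  rw [htail, sub_div, div_self hpos.ne',
    ENNReal.ofReal_sub _ (div_nonneg (scale_nonneg hlam hmu n) hpos.le), ENNReal.ofReal_one,
    ENNReal.ofReal_div_of_pos hpos, hLInf]

end ScaleTail

section NoReturnFromInfinity

variable {lam mu : ℕ → ℝ} {P : ℝ → State → State → ℝ} {t : ℝ}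

-- The hypothesis says that `(J n - δ) / R n` increases from `m` on.
theorem eventually_le_of_mul_sub_le {R J : ℕ → ℝ} {c δ : ℝ} {m : ℕ} (hR : ∀ n, 0 < R n)
    (hR0 : Tendsto R atTop (𝓝 0)) (hJ : 0 ≤ J m)
    (h : ∀ n, m ≤ n → δ * (R n - R (n + 1)) ≤ R n * J (n + 1) - R (n + 1) * J n) (hc : c < δ) :
    ∀ᶠ n in atTop, c ≤ J n := by
  have hbound (n : ℕ) (hn : m ≤ n) : -δ / R m ≤ (J n - δ) / R n := by
    induction n, hn using Nat.le_induction with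
    | base => exact div_le_div_of_nonneg_right (by linarith) (hR m).le
    | succ n hn ih =>
      refine ih.trans ?_
      rw [div_le_div_iff₀ (hR n) (hR (n + 1))]
      linarith [h n hn]
  have hlim : Tendsto (fun n => δ + -δ / R m * R n) atTop (𝓝 δ) := by
    simpa using (hR0.const_mul (-δ / R m)).const_add δ
  filter_upwards [hlim.eventually (lt_mem_nhds hc), eventually_ge_atTop m] with n hcn hmn
  have := (le_div_iff₀ (hR n)).1 (hbound n hmn)
  linarith

namespace IsTransitionFunction

theorem summable_piCoeff_of_eventually_le (hP : IsTransitionFunction lam mu P)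
    (hlam : ∀ i, 0 < lam i) (hmu : ∀ i, 1 ≤ i → 0 < mu i) (ht : 0 ≤ t) {i : ℕ} {c : ℝ} (hc : 0 < c)
    (h : ∀ᶠ n in atTop, c ≤ occupation P t i n / piCoeff lam mu n) :
    Summable (piCoeff lam mu) := by
  refine ((hP.summable_occupation ht i).div_const c).of_norm_bounded_eventually_nat ?_
  filter_upwards [h] with n hn
  have hpi := piCoeff_pos hlam hmu n
  rw [Real.norm_of_nonneg hpi.le, le_div_iff₀ hc, mul_comm]
  exact (le_div_iff₀ hpi).1 hn

theorem mul_sub_scaleTail_le (hP : IsTransitionFunction lam mu P) (hlam : ∀ i, 0 < lam i)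
    (hmu : ∀ i, 1 ≤ i → 0 < mu i) (hmu0 : 0 ≤ mu 0) (ht : 0 ≤ t) {i n : ℕ} (hin : i ≤ n) :
    (∑ j ∈ Finset.range (n + 1), P t (st i) (st j) * scaleTail lam mu j - scaleTail lam mu i) *
        (scaleTail lam mu n - scaleTail lam mu (n + 1)) ≤
      scaleTail lam mu n * (occupation P t i (n + 1) / piCoeff lam mu (n + 1)) -
        scaleTail lam mu (n + 1) * (occupation P t i n / piCoeff lam mu n) := by
  have hflux := hP.sum_mul_le_add_flux (extend_bot 0 (scaleTail lam mu) 0)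
    (gen_extend_scaleTail_nonpos hlam hmu hmu0) ht hin
  simp only [extend_st] at hflux
  have hocc (k : ℕ) :
      occupation P t i k = piCoeff lam mu k * (occupation P t i k / piCoeff lam mu k) :=
    (mul_div_cancel₀ _ (piCoeff_pos hlam hmu k).ne').symm
  rw [scaleTail_sub_succ, ← div_eq_mul_inv,
    div_le_iff₀ (mul_pos (hlam n) (piCoeff_pos hlam hmu n))]
  rw [hocc n, hocc (n + 1)] at hflux
  linear_combination hflux + scaleTail lam mu n *
    (occupation P t i (n + 1) / piCoeff lam mu (n + 1)) * mu_mul_piCoeff_succ (lam := lam) hmu n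

theorem sum_mul_scaleTail_le (hP : IsTransitionFunction lam mu P) (hlam : ∀ i, 0 < lam i)
    (hmu : ∀ i, 1 ≤ i → 0 < mu i) (hmu0 : 0 ≤ mu 0)
    (hs : Summable fun i => (lam i * piCoeff lam mu i)⁻¹) (hpi : ¬ Summable (piCoeff lam mu))
    (ht : 0 ≤ t) (i M : ℕ) :
    ∑ j ∈ Finset.range M, P t (st i) (st j) * scaleTail lam mu j ≤ scaleTail lam mu i := by
  by_contra! hlt
  set excess := ∑ j ∈ Finset.range M, P t (st i) (st j) * scaleTail lam mu j - scaleTail lam mu i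
  have hexcess : 0 < excess := sub_pos.2 hlt
  have hR := scaleTail_pos hlam hmu hs
  refine hpi (hP.summable_piCoeff_of_eventually_le (i := i) hlam hmu ht (half_pos hexcess) ?_)
  refine eventually_le_of_mul_sub_le (m := max M i) hR (tendsto_scaleTail hs)
    (div_nonneg (hP.occupation_nonneg ht i _) (piCoeff_pos hlam hmu _).le) (fun n hn => ?_)
    (half_lt_self hexcess)
  refine le_trans ?_ (hP.mul_sub_scaleTail_le hlam hmu hmu0 ht ((le_max_right _ _).trans hn))
  have hsum : ∑ j ∈ Finset.range M, P t (st i) (st j) * scaleTail lam mu j ≤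
      ∑ j ∈ Finset.range (n + 1), P t (st i) (st j) * scaleTail lam mu j :=
    Finset.sum_le_sum_of_subset_of_nonneg
      (Finset.range_mono ((le_max_left M i).trans (hn.trans n.le_succ)))
      fun j _ _ => mul_nonneg (hP.nonneg t ht _ _) (hR j).le
  refine mul_le_mul_of_nonneg_right (sub_le_sub_right hsum _) ?_
  rw [scaleTail_sub_succ]
  exact (inv_lam_mul_piCoeff_pos hlam hmu n).le

theorem tsum_ofReal_mul_extend_le (hP : IsTransitionFunction lam mu P) (ht : 0 ≤ t) {f : ℕ → ℝ}
    (hf : ∀ j, 0 ≤ f j) {x : State} {b : ℝ}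
    (h : ∀ M, ∑ j ∈ Finset.range M, P t x (st j) * f j ≤ b) :
    ∑' y, ENNReal.ofReal (P t x y) * ENNReal.ofReal (extend 0 f 0 y) ≤ ENNReal.ofReal b := by
  rw [← st_injective.tsum_eq]
  · refine ENNReal.tsum_le_of_sum_range_le fun M => ?_
    simp only [extend_st, ← ENNReal.ofReal_mul (hP.nonneg t ht _ _)]
    rw [← ENNReal.ofReal_sum_of_nonneg fun j _ => mul_nonneg (hP.nonneg t ht _ _) (hf j)]
    exact ENNReal.ofReal_le_ofReal (h M)
  · refine Function.support_subset_iff'.2 fun y hy => ?_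
    rcases state_cases y with rfl | rfl | ⟨j, rfl⟩
    · simp
    · simp
    · exact absurd ⟨j, rfl⟩ hy

end IsTransitionFunction

variable {Ω : Type*} [MeasurableSpace Ω] {X : ℝ≥0 → Ω → State} {Pr : Measure Ω} {n : ℕ}

theorem measure_hitTime_zero_le_of_not_summable (hlam : ∀ i, 0 < lam i)
    (hmu : ∀ i, 1 ≤ i → 0 < mu i) (hmu0 : 0 ≤ mu 0) (hP : IsTransitionFunction lam mu P)
    (hs : Summable fun i => (lam i * piCoeff lam mu i)⁻¹) (hpi : ¬ Summable (piCoeff lam mu))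
    (hX : IsMarkovChainFrom P (st n) X Pr) :
    Pr {ω | hitTime X 0 ω < ⊤} ≤ ENNReal.ofReal (scaleTail lam mu n / scaleTail lam mu 0) := by
  have hR := scaleTail_pos hlam hmu hs
  refine hX.measure_hitTime_lt_top_le (B := {st 0})
    (w := fun y => ENNReal.ofReal (extend 0 (fun j => scaleTail lam mu j / scaleTail lam mu 0) 0 y))
    rfl ?_ ?_
  · filter_upwards [self_mem_nhdsWithin] with t (ht0 : 0 < t) y _
    rcases state_cases y with rfl | rfl | ⟨i, rfl⟩
    · exact (hP.tsum_mul_of_absorbing ht0.le (hP.absorbing_bot t ht0.le) _).le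
    · exact (hP.tsum_mul_of_absorbing ht0.le (hP.absorbing_top t ht0.le) _).le
    · refine hP.tsum_ofReal_mul_extend_le ht0.le (fun j => (div_pos (hR j) (hR 0)).le) fun M => ?_
      simp only [extend_st, ← mul_div_assoc]
      rw [← Finset.sum_div]
      exact div_le_div_of_nonneg_right
        (hP.sum_mul_scaleTail_le hlam hmu hmu0 hs hpi ht0.le i M) (hR 0).le
  · rintro _ rfl
    rw [extend_st, div_self (hR 0).ne', ENNReal.ofReal_one]

theorem C_add_D_ne_top (hlam : ∀ i, 0 < lam i) (hmu : ∀ i, 1 ≤ i → 0 < mu i)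
    (hL : LInf lam mu ≠ ⊤) (hK : KInf lam mu ≠ ⊤) : C lam mu + D lam mu ≠ ⊤ := by
  have hK_le (n : ℕ) : ENNReal.ofReal (K lam mu n) ≤ KInf lam mu := by
    rw [K, ENNReal.ofReal_sum_of_nonneg fun i _ => (piCoeff_pos hlam hmu i).le]
    exact ENNReal.sum_le_tsum _
  have hLK := ENNReal.mul_ne_top hL hK
  rw [LInf, ← ENNReal.tsum_mul_right] at hLK
  refine ENNReal.add_ne_top.2 ⟨ne_top_of_le_ne_top hLK ?_, ne_top_of_le_ne_top hLK ?_⟩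
  · exact ENNReal.tsum_le_tsum fun n => mul_le_mul_right (hK_le n) _
  · exact ENNReal.tsum_le_tsum fun n => mul_le_mul_right tsub_le_self _

theorem measure_hitTime_zero_le_one_sub (hlam : ∀ i, 0 < lam i) (hmu : ∀ i, 1 ≤ i → 0 < mu i)
    (hmu0 : 0 ≤ mu 0) (hP : IsTransitionFunction lam mu P) (hCD : C lam mu + D lam mu = ⊤)
    (hX : IsMarkovChainFrom P (st n) X Pr) :
    Pr {ω | hitTime X 0 ω < ⊤} ≤ 1 - ENNReal.ofReal (scale lam mu n) / LInf lam mu := by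
  have := hX.isProbabilityMeasure
  by_cases hL : LInf lam mu = ⊤
  · rw [hL, ENNReal.div_top, tsub_zero]
    exact prob_le_one
  · have hs : Summable fun i => (lam i * piCoeff lam mu i)⁻¹ :=
      (ENNReal.summable_toReal hL).congr fun i =>
        ENNReal.toReal_ofReal (inv_lam_mul_piCoeff_pos hlam hmu i).le
    have hK : KInf lam mu = ⊤ := by_contra fun hK => C_add_D_ne_top hlam hmu hL hK hCD
    have hpi : ¬ Summable (piCoeff lam mu) := fun h => h.tsum_ofReal_ne_top hK
    exact (measure_hitTime_zero_le_of_not_summable hlam hmu hmu0 hP hs hpi hX).trans_eq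
      (ofReal_scaleTail_div hlam hmu hs n)

end NoReturnFromInfinity

end BirthDeath

open BirthDeath in
theorem corollary1 (lam mu : ℕ → ℝ) (hlam : ∀ i, 0 < lam i) (hmu : ∀ i, 1 ≤ i → 0 < mu i)
    (hmu0 : 0 ≤ mu 0) (P : ℝ → State → State → ℝ) (hP : IsTransitionFunction lam mu P)
    {Ω : Type*} [MeasurableSpace Ω] (n : ℕ) (hn : 1 ≤ n) :
    (∀ (Pr : Measure Ω) (X : ℝ≥0 → Ω → State), IsMarkovChainFrom P (st 0) X Pr →
      Pr {ω | hitTime X n ω < ⊤} = ENNReal.ofReal (1 / (1 + mu 0 * L lam mu (n - 1)))) ∧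
    (C lam mu + D lam mu = ⊤ →
      ∀ (Pr : Measure Ω) (X : ℝ≥0 → Ω → State), IsMarkovChainFrom P (st n) X Pr →
        Pr {ω | hitTime X 0 ω < ⊤} =
          1 - ENNReal.ofReal (L lam mu (n - 1)) / LInf lam mu) := by
  rw [L_sub_one hn]
  refine ⟨fun Pr X hX => ?_, fun hCD Pr X hX => le_antisymm ?_ ?_⟩
  · exact measure_hitTime_lt_top_of_zero hlam hmu hmu0 hP hX
  · exact measure_hitTime_zero_le_one_sub hlam hmu hmu0 hP hCD hX
  · exact one_sub_le_measure_hitTime_zero hlam hmu hmu0 hP hX
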